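/- There is an absolute constant $C$ such that the following holds. Let $P$ be a set of $n\ge 1$ points in the plane in convex position (no point of $P$ lies in the convex hull of the other points), and let $T$ be a spanning tree on $P$, with every edge drawn as the straight-line segment between its endpoints. Two distinct edges cross if their segments have a common interior point, and a tree is plane if no two of its edges cross. A flip removes two crossing edges $ab$ and $cd$ of a spanning tree and adds either $ac$ and $bd$, or $ad$ and $bc$, such that the resulting graph is again a spanning tree on $P$. Let $f(T)$ be the minimum $k$ for which there is a sequence $T=T_0,T_1,\dots,T_k$ of spanning trees on $P$ such that each $T_{i+1}$ is obtained from $T_i$ by a single flip and $T_k$ is plane. Then such a sequence exists, and $$f(T)\le C\, n\log n .$$ -/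

import Mathlib

namespace GeomGraph

/-- The Euclidean plane. -/
abbrev Plane : Type := EuclideanSpace ℝ (Fin 2)

variable {V : Type*}

/-! A geometric graph is a simple graph `G` on `V` together with the positions `p : V → Plane` of
its vertices; the edge `s(a, b)` is drawn as the straight-line segment from `p a` to `p b`. -/

/-- The segments `ab` and `cd` are distinct and cross: they have a common relative interior point.
For points in general position (in particular in convex position) this is the usual proper
crossing, and the four endpoints are then distinct. -/
def Cross (p : V → Plane) (a b c d : V) : Prop :=
  s(a, b) ≠ s(c, d) ∧
    (openSegment ℝ (p a) (p b) ∩ openSegment ℝ (p c) (p d)).Nonempty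

/-- A geometric graph is plane if no two of its edges cross. -/
def IsPlane (p : V → Plane) (G : SimpleGraph V) : Prop :=
  ∀ a b c d : V, G.Adj a b → G.Adj c d → ¬ Cross p a b c d

/-- `T'` is obtained from the spanning tree `T` by a single flip: two crossing edges `ab` and `cd`
are replaced by `ac` and `bd`, and the result is again a spanning tree. The other replacement, by
`ad` and `bc`, is the same condition with the names of `c` and `d` exchanged. -/
def IsTreeFlip (p : V → Plane) (T T' : SimpleGraph V) : Prop :=
  ∃ a b c d : V, T.Adj a b ∧ T.Adj c d ∧ Cross p a b c d ∧
    T' = T.deleteEdges {s(a, b), s(c, d)} ⊔ SimpleGraph.fromEdgeSet {s(a, c), s(b, d)} ∧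
    T'.IsTree

/-- There is a valid flip sequence `T = S 0, S 1, …, S k` of length `k`: each graph is obtained
from the previous one by a single flip, and the last one is plane. -/
def HasFlipSequence (p : V → Plane) (T : SimpleGraph V) (k : ℕ) : Prop :=
  ∃ S : ℕ → SimpleGraph V, S 0 = T ∧ (∀ i < k, IsTreeFlip p (S i) (S (i + 1))) ∧ IsPlane p (S k)

/-- `f` is the minimum length of a valid flip sequence that uncrosses `T` (in particular such a
sequence exists). -/
def IsMinFlips (p : V → Plane) (T : SimpleGraph V) (f : ℕ) : Prop :=
  IsLeast {k : ℕ | HasFlipSequence p T k} f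

/-- A set of points is in convex position if none of its points lies in the convex hull of the
others (points of the set indexed by themselves). -/
def InConvexPosition (P : Finset Plane) : Prop :=
  ConvexIndependent ℝ (fun x : P => (x : Plane))

end GeomGraph

/-! Number the points counterclockwise. Two edges cross exactly when their endpoints alternate in
this order, so the problem becomes combinatorial.

For crossing edges on `a < c < b < d`, removing both leaves a forest in which some end of one edge
is still connected to some end of the other, so at least one of the two replacements gives a tree
(`exists_isTreeFlip`). There is no control over which, so the crossing must be one for which both
replacements make progress.

Progress is measured by `weight`, the product of the lengths of all crossed edges, where length
counts only endpoints of crossed edges. Take a shortest crossed edge `s` and its middle vertex in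
this count. That vertex is an endpoint of a crossed edge `t`, which is at least as long as `s` and
therefore leaves the span of `s` and crosses it. If `x`, `y`, `z` are the three consecutive gaps,
then `(x + y) * (y + z) = x * z + y * (x + y + z)`: the old product of lengths is the sum of the two
possible new ones. Neither summand is below a ninth of the total, so either flip multiplies the
weight by at most `8/9` (`exists_balanced_crossing`, `weight_replace_le`). The weight is a positive
integer, initially at most `n ^ n`, so at most `n * log n / log (9/8)` flips occur. -/

namespace GeomGraph

/-! ### Orientation and the cyclic order of points in convex position. -/

/-- Twice the signed area of the triangle `x y z`. -/
def orient (x y z : Plane) : ℝ :=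
  (y 0 - x 0) * (z 1 - x 1) - (y 1 - x 1) * (z 0 - x 0)

theorem plane_ext {x y : Plane} (h0 : x 0 = y 0) (h1 : x 1 = y 1) : x = y := by
  ext i
  fin_cases i
  · exact h0
  · exact h1

theorem mem_convexHull_triple {x y z w : Plane} (h : 0 < orient x y z)
    (hx : 0 ≤ orient w y z) (hy : 0 ≤ orient x w z) (hz : 0 ≤ orient x y w) :
    w ∈ convexHull ℝ ({x, y, z} : Set Plane) := by
  have hsum : orient w y z + orient x w z + orient x y w = orient x y z := by
    simp only [orient]; ring
  have key : w = ∑ i : Fin 3, (![orient w y z / orient x y z, orient x w z / orient x y z,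
      orient x y w / orient x y z] i) • (![x, y, z] i) := by
    have h' := h.ne'
    apply plane_ext <;> simp [Fin.sum_univ_three] <;> field_simp <;> simp only [orient] <;> ring
  rw [key]
  refine (convex_convexHull ℝ _).sum_mem ?_ ?_ ?_
  · intro i _
    fin_cases i <;> simp <;> positivity
  · simp [Fin.sum_univ_three]
    field_simp
    exact hsum
  · intro i _
    apply subset_convexHull
    fin_cases i <;> simp

variable {V : Type*} {p : V → Plane}

/-- A vertex of a finite set in convex position is strictly separated from the others. -/
theorem exists_separating_functional [Finite V] (hp : ConvexIndependent ℝ p) (o : V) :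
    ∃ α β : ℝ, ∀ v, v ≠ o → 0 < α * (p v 0 - p o 0) + β * (p v 1 - p o 1) := by
  have hfin : (p '' {o}ᶜ).Finite := Set.toFinite _
  have hmem : p o ∉ convexHull ℝ (p '' {o}ᶜ) := fun h => hp _ _ h rfl
  obtain ⟨f, u, hu, hf⟩ := geometric_hahn_banach_point_closed (convex_convexHull ℝ _)
    (hfin.isClosed_convexHull ℝ) hmem
  have hlin : ∀ x : Plane, f x = f (EuclideanSpace.single 0 1) * x 0 +
      f (EuclideanSpace.single 1 1) * x 1 := by
    intro x
    have hx : x = x 0 • EuclideanSpace.single 0 (1 : ℝ) + x 1 • EuclideanSpace.single 1 (1 : ℝ) := by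
      apply plane_ext <;> simp
    conv_lhs => rw [hx]
    simp [mul_comm]
  refine ⟨f (EuclideanSpace.single 0 1), f (EuclideanSpace.single 1 1), fun v hv => ?_⟩
  have h1 := hf (p v) (subset_convexHull ℝ _ ⟨v, hv, rfl⟩)
  rw [hlin] at h1 hu
  linarith

theorem not_mem_segment_of_convexIndependent (hp : ConvexIndependent ℝ p) {a b c : V}
    (hab : b ≠ a) (hbc : b ≠ c) : p b ∉ segment ℝ (p a) (p c) := by
  intro h
  rw [← convexHull_pair, ← Set.image_pair] at h
  rcases hp _ _ h with h | h
  · exact hab h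
  · exact hbc h

theorem orient_ne_zero [Finite V] (hp : ConvexIndependent ℝ p) {o a b : V} (ha : a ≠ o)
    (hb : b ≠ o) (hab : a ≠ b) : orient (p o) (p a) (p b) ≠ 0 := by
  intro h
  obtain ⟨α, β, hf⟩ := exists_separating_functional hp o
  wlog hle : α * (p a 0 - p o 0) + β * (p a 1 - p o 1) ≤
      α * (p b 0 - p o 0) + β * (p b 1 - p o 1) generalizing a b
  · refine this hb ha hab.symm ?_ (le_of_not_ge hle)
    rw [← neg_eq_zero, ← h]
    simp only [orient]; ring
  refine not_mem_segment_of_convexIndependent hp ha hab ?_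
  have h1 := hf a ha
  have h2 := hf b hb
  set u := α * (p a 0 - p o 0) + β * (p a 1 - p o 1) with hu
  set v := α * (p b 0 - p o 0) + β * (p b 1 - p o 1) with hv
  -- On a line through `p o`, the functional is proportional to signed distance from `p o`, so `u /
  -- v` is the position of `p a` on the segment from `p o` to `p b`.
  refine ⟨1 - u / v, u / v, ?_, by positivity, by ring, ?_⟩
  · rw [sub_nonneg, div_le_one h2]; exact hle
  · simp only [orient] at h
    have h2' := h2.ne'
    apply plane_ext
    · simp only [PiLp.add_apply, PiLp.smul_apply, smul_eq_mul]
      field_simp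
      rw [hu, hv]
      linear_combination (-β) * h
    · simp only [PiLp.add_apply, PiLp.smul_apply, smul_eq_mul]
      field_simp
      rw [hu, hv]
      linear_combination α * h

/-- Angular order around a vertex: comparison is transitive. -/
theorem orient_trans [Finite V] (hp : ConvexIndependent ℝ p) {o a b c : V}
    (hab : 0 < orient (p o) (p a) (p b)) (hbc : 0 < orient (p o) (p b) (p c)) :
    0 < orient (p o) (p a) (p c) := by
  obtain ⟨α, β, hf⟩ := exists_separating_functional hp o
  have ha := hf a (by rintro rfl; simp [orient] at hab)
  have hb := hf b (by rintro rfl; simp [orient] at hbc)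
  have hc := hf c (by rintro rfl; simp [orient] at hbc)
  -- A Plücker relation between the three directions seen from `p o`. The functional is positive on
  -- all of them, so they lie in an open half-plane, where angles cannot wrap around.
  have key : orient (p o) (p a) (p c) * (α * (p b 0 - p o 0) + β * (p b 1 - p o 1)) =
      orient (p o) (p a) (p b) * (α * (p c 0 - p o 0) + β * (p c 1 - p o 1)) +
      orient (p o) (p b) (p c) * (α * (p a 0 - p o 0) + β * (p a 1 - p o 1)) := by
    simp only [orient]; ring
  refine pos_of_mul_pos_left ?_ hb.le
  rw [key]
  positivity

/-- Vertices in convex position can be numbered counterclockwise. -/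
theorem exists_linearOrder_orient_pos [Finite V] (hp : ConvexIndependent ℝ p) :
    ∃ _ : LinearOrder V, ∀ a b c : V, a < b → b < c → 0 < orient (p a) (p b) (p c) := by
  classical
  rcases isEmpty_or_nonempty V with hV | ⟨⟨o⟩⟩
  · exact ⟨LinearOrder.lift' (fun v : V => (hV.elim v : ℕ)) (fun v => hV.elim v),
      fun a => hV.elim a⟩
  -- The base point `o` comes first; the others follow by angle around it.
  let r : V → V → Prop := fun a b => (a = o ∧ b ≠ o) ∨ 0 < orient (p o) (p a) (p b)
  have hne : ∀ {a b}, 0 < orient (p o) (p a) (p b) → a ≠ o ∧ b ≠ o := by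
    intro a b h
    constructor <;> rintro rfl <;> simp [orient] at h
  have hself : ∀ a b, orient (p a) (p b) (p b) = 0 := by
    intro a b; simp only [orient]; ring
  have hswap : ∀ a b, orient (p o) (p b) (p a) = - orient (p o) (p a) (p b) := by
    intro a b; simp only [orient]; ring
  have hr : IsStrictTotalOrder V r :=
    { trichotomous := by
        intro a b h1 h2
        by_contra hab
        simp only [r, not_or, not_and, not_not, not_lt] at h1 h2
        by_cases ha : a = o
        · exact hab (ha.trans (h1.1 ha).symm)
        by_cases hb : b = o
        · exact ha (h2.1 hb)
        have := hswap a b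
        exact orient_ne_zero hp ha hb hab (by linarith [h1.2, h2.2])
      irrefl := by
        rintro a (⟨h1, h2⟩ | h)
        · exact h2 h1
        · rw [hself] at h; exact lt_irrefl _ h
      trans := by
        rintro a b c (⟨h1, h2⟩ | h) (⟨h3, h4⟩ | h')
        · exact Or.inl ⟨h1, h4⟩
        · exact Or.inl ⟨h1, (hne h').2⟩
        · exact absurd h3 (hne h).2
        · exact Or.inr (orient_trans hp h h') }
  refine ⟨linearOrderOfSTO r, fun a b c hab hbc => ?_⟩
  change r a b at hab
  change r b c at hbc
  rcases hab with ⟨rfl, hb⟩ | hab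
  · rcases hbc with ⟨h1, _⟩ | h
    · exact absurd h1 hb
    · exact h
  rcases hbc with ⟨h1, _⟩ | hbc
  · exact absurd h1 (hne hab).2
  have hac := orient_trans hp hab hbc
  by_contra hcon
  -- A wrong turn at `b` would put `p b` in the triangle `o a c`.
  have hmem := mem_convexHull_triple hac (w := p b) (by
    have : orient (p b) (p a) (p c) = - orient (p a) (p b) (p c) := by
      simp only [orient]; ring
    linarith) hbc.le hab.le
  have himg : ({p o, p a, p c} : Set Plane) = p '' {o, a, c} := by
    simp [Set.image_insert_eq]
  rw [himg] at hmem
  rcases hp _ _ hmem with h | h | h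
  · exact (hne hab).2 h
  · rw [h, hself] at hab; exact lt_irrefl _ hab
  · rw [h, hself] at hbc; exact lt_irrefl _ hbc

/-! ### Crossing segments and alternating endpoints. -/

theorem orient_combo (x y z w : Plane) {s t : ℝ} (h : s + t = 1) :
    orient x y (s • z + t • w) = s * orient x y z + t * orient x y w := by
  obtain rfl : t = 1 - s := by linarith
  simp only [orient, PiLp.add_apply, PiLp.smul_apply, smul_eq_mul]
  ring

theorem orient_eq_zero_of_mem_openSegment {x y z : Plane} (h : z ∈ openSegment ℝ x y) :
    orient x y z = 0 := by
  obtain ⟨s, t, -, -, hst, rfl⟩ := h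
  rw [orient_combo _ _ _ _ hst]
  simp only [orient]; ring

theorem orient_pos_of_mem_openSegment {x y z w v : Plane} (h : v ∈ openSegment ℝ z w)
    (hz : 0 ≤ orient x y z) (hw : 0 ≤ orient x y w) (hzw : 0 < orient x y z + orient x y w) :
    0 < orient x y v := by
  obtain ⟨s, t, hs, ht, hst, rfl⟩ := h
  rw [orient_combo _ _ _ _ hst]
  rcases hz.lt_or_eq with h | h
  · have := mul_pos hs h
    have := mul_nonneg ht.le hw
    linarith
  · rw [← h] at hzw ⊢
    have := mul_pos ht (by simpa using hzw)
    simpa using this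

section Order

variable [LinearOrder V] (ho : ∀ a b c : V, a < b → b < c → 0 < orient (p a) (p b) (p c))
include ho

theorem cross_of_interleaved {a b c d : V} (hac : a < c) (hcb : c < b) (hbd : b < d) :
    Cross p a b c d := by
  refine ⟨?_, ?_⟩
  · intro h
    rcases Sym2.eq_iff.1 h with ⟨h, -⟩ | ⟨h, -⟩
    · exact hac.ne h
    · exact (hac.trans (hcb.trans hbd)).ne h
  have h1 := ho _ _ _ hcb hbd
  have h2 := ho _ _ _ hac (hcb.trans hbd)
  have h3 := ho _ _ _ (hac.trans hcb) hbd
  have h4 := ho _ _ _ hac hcb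
  have hsum : orient (p c) (p b) (p d) + orient (p a) (p c) (p d) =
      orient (p a) (p b) (p d) + orient (p a) (p c) (p b) := by
    simp only [orient]; ring
  set A := orient (p c) (p b) (p d) with hA
  set B := orient (p a) (p c) (p d) with hB
  set C := orient (p a) (p b) (p d) with hC
  set D := orient (p a) (p c) (p b) with hD
  -- Each endpoint is weighted by the distance of the opposite endpoint from the other line. The
  -- common denominator is twice the area of the quadrilateral.
  refine ⟨(A / (A + B)) • p a + (B / (A + B)) • p b,
    ⟨A / (A + B), B / (A + B), by positivity, by positivity, by field_simp, rfl⟩,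
    ⟨C / (A + B), D / (A + B), by positivity, by positivity, ?_, ?_⟩⟩
  · rw [← add_div, ← hsum, div_self (by positivity)]
  · have : A + B ≠ 0 := by positivity
    apply plane_ext <;> simp only [PiLp.add_apply, PiLp.smul_apply, smul_eq_mul] <;> field_simp <;>
      rw [hA, hB, hC, hD] <;> simp only [orient] <;> ring

theorem orient_nonneg_of_le {a b c : V} (hab : a ≤ b) (hbc : b ≤ c) :
    0 ≤ orient (p a) (p b) (p c) := by
  rcases hab.lt_or_eq with h | rfl
  · rcases hbc.lt_or_eq with h' | rfl
    · exact (ho _ _ _ h h').le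
    · exact le_of_eq (by simp only [orient]; ring)
  · exact le_of_eq (by simp only [orient]; ring)

/-- If the endpoints do not alternate, the edges are side by side or nested. Then one of them lies
in a closed half-plane of the line through the other and is not contained in that line, so its
relative interior misses the line. -/
theorem interleaved_of_cross {a b c d : V} (hab : a < b) (hcd : c < d) (h : Cross p a b c d) :
    (a < c ∧ c < b ∧ b < d) ∨ (c < a ∧ a < d ∧ d < b) := by
  obtain ⟨hne, v, hv1, hv2⟩ := h
  have z1 := orient_eq_zero_of_mem_openSegment hv1
  have z2 := orient_eq_zero_of_mem_openSegment hv2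
  have rot : ∀ x y z, orient x y z = orient y z x := by
    intro x y z; simp only [orient]; ring
  have disjoint_case : ∀ {a b c d : V}, a < b → c < d → b ≤ c →
      v ∈ openSegment ℝ (p c) (p d) → 0 < orient (p a) (p b) v := by
    intro a b c d hab hcd hbc hv
    have h1 := orient_nonneg_of_le ho hab.le hbc
    have h2 := ho _ _ _ hab (hbc.trans_lt hcd)
    exact orient_pos_of_mem_openSegment hv h1 h2.le (by linarith)
  have nested_case : ∀ {a b c d : V}, c < d → a ≤ c → d ≤ b → (a < c ∨ d < b) →
      v ∈ openSegment ℝ (p a) (p b) → 0 < orient (p c) (p d) v := by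
    intro a b c d hcd hac hdb hs hv
    have h1 := orient_nonneg_of_le ho hac hcd.le
    have h2 := orient_nonneg_of_le ho hcd.le hdb
    rw [rot] at h1
    refine orient_pos_of_mem_openSegment hv h1 h2 ?_
    rcases hs with hs | hs
    · have := ho _ _ _ hs hcd
      rw [rot] at this
      linarith
    · have := ho _ _ _ hcd hs
      linarith
  by_contra hcon
  simp only [not_or, not_and, not_lt] at hcon
  obtain ⟨k1, k2⟩ := hcon
  rcases le_or_gt b c with hbc | hcb
  · exact (disjoint_case hab hcd hbc hv2).ne' z1
  rcases le_or_gt d a with hda | had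
  · exact (disjoint_case hcd hab hda hv1).ne' z2
  rcases lt_trichotomy a c with hac | rfl | hca
  · exact (nested_case hcd hac.le (k1 hac hcb) (Or.inl hac) hv1).ne' z2
  · rcases lt_trichotomy b d with hbd | rfl | hdb
    · exact (nested_case hab le_rfl hbd.le (Or.inr hbd) hv2).ne' z1
    · exact hne rfl
    · exact (nested_case hcd le_rfl hdb.le (Or.inr hdb) hv1).ne' z2
  · exact (nested_case hab hca.le (k2 hca had) (Or.inl hca) hv2).ne' z1

end Order

/-! ### Flips that preserve trees. -/

theorem mem_of_adj_closed {G : SimpleGraph V} (hG : G.Connected) {S : Set V} {a : V}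
    (ha : a ∈ S) (hS : ∀ x y, x ∈ S → G.Adj x y → y ∈ S) (v : V) : v ∈ S := by
  obtain ⟨w⟩ := hG.preconnected a v
  induction w with
  | nil => exact ha
  | cons h _ ih => exact ih (hS _ _ ha h)

/-- Replacing two edges `ab`, `cd` of a tree by `ac`, `bd` yields a tree if `b` and `c` remain
connected after the removal. -/
theorem isTree_flip_of_reachable [Finite V] {T : SimpleGraph V} (hT : T.IsTree) {a b c d : V}
    (hab : T.Adj a b) (hcd : T.Adj c d) (hne : s(a, b) ≠ s(c, d)) (hac : a ≠ c) (hbd : b ≠ d)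
    (hbc : (T.deleteEdges {s(a, b), s(c, d)}).Reachable b c) :
    (T.deleteEdges {s(a, b), s(c, d)} ⊔
      SimpleGraph.fromEdgeSet {s(a, c), s(b, d)}).IsTree := by
  classical
  have := Fintype.ofFinite V
  set F := T.deleteEdges {s(a, b), s(c, d)} with hF
  set T' := F ⊔ SimpleGraph.fromEdgeSet {s(a, c), s(b, d)} with hT'
  have hFT : F ≤ T' := le_sup_left
  have rbc : T'.Reachable b c := hbc.mono hFT
  have rac : T'.Reachable a c := SimpleGraph.Adj.reachable (by simp [hT', hac])
  have rbd : T'.Reachable b d := SimpleGraph.Adj.reachable (by simp [hT', hbd])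
  have rab : T'.Reachable a b := rac.trans rbc.symm
  have rad : T'.Reachable a d := rab.trans rbd
  have hall : ∀ v, T'.Reachable a v := by
    refine mem_of_adj_closed hT.connected (S := {v | T'.Reachable a v}) (a := a)
      (SimpleGraph.Reachable.refl a) ?_
    intro x y hx hxy
    by_cases h : s(x, y) ∈ ({s(a, b), s(c, d)} : Set (Sym2 V))
    · rcases h with h | h <;> rcases Sym2.eq_iff.1 h with ⟨rfl, rfl⟩ | ⟨rfl, rfl⟩
      · exact rab
      · exact SimpleGraph.Reachable.refl _
      · exact rad
      · exact rac
    · exact SimpleGraph.Reachable.trans hx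
        (SimpleGraph.Adj.reachable (hFT ((SimpleGraph.deleteEdges_adj).2 ⟨hxy, h⟩)))
  have hconn : T'.Connected := by
    have : Nonempty V := ⟨a⟩
    exact ⟨fun x y => (hall x).symm.trans (hall y)⟩
  -- Given connectedness, it is enough that the number of edges does not grow: two are removed and
  -- at most two added.
  rw [SimpleGraph.isTree_iff_connected_and_card]
  refine ⟨hconn, le_antisymm ?_ hconn.card_vert_le_card_edgeSet_add_one⟩
  have hcard := (SimpleGraph.isTree_iff_connected_and_card.1 hT).2
  rw [← hcard]
  have hsub : T'.edgeSet ⊆ (T.edgeSet \ {s(a, b), s(c, d)}) ∪ {s(a, c), s(b, d)} := by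
    intro e he
    rw [hT', SimpleGraph.edgeSet_sup, SimpleGraph.edgeSet_deleteEdges,
      SimpleGraph.edgeSet_fromEdgeSet] at he
    exact he.imp id fun h => h.1
  have h1 : T'.edgeSet.ncard ≤ (T.edgeSet \ {s(a, b), s(c, d)}).ncard + 2 :=
    (Set.ncard_le_ncard hsub (Set.toFinite _)).trans <| (Set.ncard_union_le _ _).trans <|
      Nat.add_le_add_left (Set.ncard_insert_le _ _ |>.trans (by simp)) _
  have hpair : ({s(a, b), s(c, d)} : Set (Sym2 V)) ⊆ T.edgeSet := by
    rintro e (rfl | rfl)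
    · exact hab
    · exact hcd
  have h2 := Set.ncard_sdiff_add_ncard_of_subset hpair (Set.toFinite _)
  rw [Set.ncard_pair hne] at h2
  rw [h2] at h1
  simpa only [Nat.card_coe_set_eq, Nat.add_le_add_iff_right] using h1

theorem Cross.swap_left {p : V → Plane} {a b c d : V} (h : Cross p a b c d) :
    Cross p b a c d := by
  unfold Cross at *
  rwa [Sym2.eq_swap, openSegment_symm]

theorem Cross.swap_right {p : V → Plane} {a b c d : V} (h : Cross p a b c d) :
    Cross p a b d c := by
  unfold Cross at *
  rwa [Sym2.eq_swap (a := d), openSegment_symm ℝ (p d)]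

/-- Any two crossing edges of a tree can be flipped. -/
theorem exists_isTreeFlip [Finite V] {p : V → Plane} {T : SimpleGraph V} (hT : T.IsTree)
    {a b c d : V} (hab : T.Adj a b) (hcd : T.Adj c d) (hX : Cross p a b c d)
    (hac : a ≠ c) (had : a ≠ d) (hbc : b ≠ c) (hbd : b ≠ d) :
    ∃ T', T'.IsTree ∧ IsTreeFlip p T T' ∧
      (T'.edgeSet ⊆ (T.edgeSet \ {s(a, b), s(c, d)}) ∪ {s(a, c), s(b, d)} ∨
        T'.edgeSet ⊆ (T.edgeSet \ {s(a, b), s(c, d)}) ∪ {s(a, d), s(b, c)}) := by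
  have hsub : ∀ a b c d : V, (T.deleteEdges {s(a, b), s(c, d)} ⊔
      SimpleGraph.fromEdgeSet {s(a, c), s(b, d)}).edgeSet ⊆
      (T.edgeSet \ {s(a, b), s(c, d)}) ∪ {s(a, c), s(b, d)} := by
    intro a b c d e he
    rw [SimpleGraph.edgeSet_sup, SimpleGraph.edgeSet_deleteEdges,
      SimpleGraph.edgeSet_fromEdgeSet] at he
    exact he.imp id fun h => h.1
  set F := T.deleteEdges {s(a, b), s(c, d)} with hF
  -- Otherwise the vertices reachable from `a` or `b` in `F` would be closed under adjacency in `T`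
  -- and miss `c`.
  have main : F.Reachable a c ∨ F.Reachable b c ∨ F.Reachable a d ∨ F.Reachable b d := by
    by_contra hcon
    simp only [not_or] at hcon
    obtain ⟨n1, n2, n3, n4⟩ := hcon
    have := mem_of_adj_closed hT.connected
      (S := {v | F.Reachable a v ∨ F.Reachable b v}) (a := a)
      (Or.inl (SimpleGraph.Reachable.refl a)) ?_ c
    · exact this.elim n1 n2
    intro x y hx hxy
    by_cases h : s(x, y) ∈ ({s(a, b), s(c, d)} : Set (Sym2 V))
    · rcases h with h | h <;> rcases Sym2.eq_iff.1 h with ⟨rfl, rfl⟩ | ⟨rfl, rfl⟩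
      · exact Or.inr (SimpleGraph.Reachable.refl _)
      · exact Or.inl (SimpleGraph.Reachable.refl _)
      · exact (hx.elim n1 n2).elim
      · exact (hx.elim n3 n4).elim
    · have : F.Reachable x y :=
        SimpleGraph.Adj.reachable ((SimpleGraph.deleteEdges_adj).2 ⟨hxy, h⟩)
      exact hx.imp (fun k => k.trans this) (fun k => k.trans this)
  rcases main with h | h | h | h
  · have hs : ({s(b, a), s(c, d)} : Set (Sym2 V)) = {s(a, b), s(c, d)} := by
      rw [Sym2.eq_swap]
    have ht := isTree_flip_of_reachable hT hab.symm hcd hX.swap_left.1 hbc had (by rwa [hs])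
    refine ⟨_, ht, ⟨b, a, c, d, hab.symm, hcd, hX.swap_left, rfl, ht⟩, Or.inr ?_⟩
    refine (hsub b a c d).trans ?_
    rw [hs, Set.pair_comm s(b, c)]
  · have ht := isTree_flip_of_reachable hT hab hcd hX.1 hac hbd h
    exact ⟨_, ht, ⟨a, b, c, d, hab, hcd, hX, rfl, ht⟩, Or.inl (hsub a b c d)⟩
  · have hs : ({s(b, a), s(d, c)} : Set (Sym2 V)) = {s(a, b), s(c, d)} := by
      rw [Sym2.eq_swap, Sym2.eq_swap (a := d)]
    have ht := isTree_flip_of_reachable hT hab.symm hcd.symm hX.swap_left.swap_right.1 hbd hac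
      (by rwa [hs])
    refine ⟨_, ht, ⟨b, a, d, c, hab.symm, hcd.symm, hX.swap_left.swap_right, rfl, ht⟩, Or.inl ?_⟩
    refine (hsub b a d c).trans ?_
    rw [hs, Set.pair_comm s(b, d)]
  · have hs : ({s(a, b), s(d, c)} : Set (Sym2 V)) = {s(a, b), s(c, d)} := by
      rw [Sym2.eq_swap (a := d)]
    have ht := isTree_flip_of_reachable hT hab hcd.symm hX.swap_right.1 had hbc (by rwa [hs])
    refine ⟨_, ht, ⟨a, b, d, c, hab, hcd.symm, hX.swap_right, rfl, ht⟩, Or.inr ?_⟩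
    refine (hsub a b d c).trans ?_
    rw [hs]

theorem HasFlipSequence.cons {T T' : SimpleGraph V} {k : ℕ} (h : IsTreeFlip p T T')
    (hk : HasFlipSequence p T' k) : HasFlipSequence p T (k + 1) := by
  obtain ⟨S, hS0, hS, hplane⟩ := hk
  refine ⟨fun i => Nat.casesOn i T S, rfl, ?_, hplane⟩
  intro i hi
  cases i with
  | zero =>
    change IsTreeFlip p T (S 0)
    rwa [hS0]
  | succ i => exact hS i (by omega)

/-! ### The weight and its decrease under a balanced flip. -/

section Potential

variable {V : Type*} [LinearOrder V]

/-- The endpoints of the two edges alternate; an edge is given as the pair of its endpoints, the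
smaller one first. -/
def Interleaved (e f : V × V) : Prop := e.1 < f.1 ∧ f.1 < e.2 ∧ e.2 < f.2

instance (e f : V × V) : Decidable (Interleaved e f) :=
  inferInstanceAs (Decidable (_ ∧ _ ∧ _))

/-- The edges that are crossed by some other edge. -/
def active (E : Finset (V × V)) : Finset (V × V) :=
  E.filter fun e => ∃ f ∈ E, Interleaved e f ∨ Interleaved f e

/-- The endpoints of the crossed edges. -/
def activeVerts (E : Finset (V × V)) : Finset V :=
  (active E).image Prod.fst ∪ (active E).image Prod.snd

/-- The length of an edge, measured by the number of points of `S` it spans. -/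
def len (S : Finset V) (a b : V) : ℕ := (S.filter fun v => a < v ∧ v ≤ b).card

/-- The product of the lengths of all crossed edges. -/
def weight (E : Finset (V × V)) : ℕ := ∏ e ∈ active E, len (activeVerts E) e.1 e.2

theorem mem_active {E : Finset (V × V)} {e : V × V} :
    e ∈ active E ↔ e ∈ E ∧ ∃ f ∈ E, Interleaved e f ∨ Interleaved f e := by
  simp [active]

theorem mem_activeVerts {E : Finset (V × V)} {v : V} :
    v ∈ activeVerts E ↔ ∃ e ∈ active E, e.1 = v ∨ e.2 = v := by
  simp only [activeVerts, Finset.mem_union, Finset.mem_image]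
  constructor
  · rintro (⟨e, he, h⟩ | ⟨e, he, h⟩)
    · exact ⟨e, he, Or.inl h⟩
    · exact ⟨e, he, Or.inr h⟩
  · rintro ⟨e, he, h | h⟩
    · exact Or.inl ⟨e, he, h⟩
    · exact Or.inr ⟨e, he, h⟩

theorem len_add (S : Finset V) {a b c : V} (hab : a ≤ b) (hbc : b ≤ c) :
    len S a c = len S a b + len S b c := by
  unfold len
  rw [← Finset.card_union_of_disjoint]
  · congr 1
    ext v
    simp only [Finset.mem_filter, Finset.mem_union]
    constructor
    · rintro ⟨hv, h1, h2⟩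
      rcases le_or_gt v b with h | h
      · exact Or.inl ⟨hv, h1, h⟩
      · exact Or.inr ⟨hv, h, h2⟩
    · rintro (⟨hv, h1, h2⟩ | ⟨hv, h1, h2⟩)
      · exact ⟨hv, h1, h2.trans hbc⟩
      · exact ⟨hv, hab.trans_lt h1, h2⟩
  · rw [Finset.disjoint_left]
    intro v h1 h2
    exact absurd (Finset.mem_filter.1 h1).2.2 (not_le.2 (Finset.mem_filter.1 h2).2.1)

theorem len_pos {S : Finset V} {a b : V} (hab : a < b) (hb : b ∈ S) : 1 ≤ len S a b :=
  Finset.card_pos.2 ⟨b, Finset.mem_filter.2 ⟨hb, hab, le_rfl⟩⟩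

theorem len_mono {S S' : Finset V} (h : S ⊆ S') (a b : V) : len S a b ≤ len S' a b :=
  Finset.card_le_card (Finset.filter_subset_filter _ h)

theorem exists_card_filter_le_eq (A : Finset V) (k : ℕ) (h1 : 1 ≤ k) (hk : k ≤ A.card) :
    ∃ c ∈ A, (A.filter (· ≤ c)).card = k := by
  induction A using Finset.induction_on_max with
  | empty => simp at hk; omega
  | insert m A hm ih =>
    have hmA : m ∉ A := fun h => lt_irrefl _ (hm m h)
    rw [Finset.card_insert_of_notMem hmA] at hk
    rcases hk.lt_or_eq with hlt | heq
    · obtain ⟨c, hc, hcard⟩ := ih (by omega)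
      refine ⟨c, Finset.mem_insert_of_mem hc, ?_⟩
      rw [Finset.filter_insert, if_neg (not_le.2 (hm c hc)), hcard]
    · refine ⟨m, Finset.mem_insert_self _ _, ?_⟩
      rw [Finset.filter_true_of_mem, Finset.card_insert_of_notMem hmA, heq]
      intro x hx
      rcases Finset.mem_insert.1 hx with rfl | hx
      · exact le_rfl
      · exact (hm x hx).le

theorem exists_len_eq (S : Finset V) {a b : V} {k : ℕ} (h1 : 1 ≤ k) (hk : k ≤ len S a b) :
    ∃ c ∈ S, a < c ∧ c ≤ b ∧ len S a c = k := by
  obtain ⟨c, hc, hcard⟩ := exists_card_filter_le_eq _ k h1 hk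
  obtain ⟨hcS, hac, hcb⟩ := Finset.mem_filter.1 hc
  refine ⟨c, hcS, hac, hcb, ?_⟩
  rw [← hcard, len, Finset.filter_filter]
  congr 1
  ext v
  simp only [Finset.mem_filter]
  constructor
  · rintro ⟨hv, h, h'⟩
    exact ⟨hv, ⟨h, h'.trans hcb⟩, h'⟩
  · rintro ⟨hv, ⟨h, -⟩, h'⟩
    exact ⟨hv, h, h'⟩

/-- If some edges cross, then there are crossing edges with a balanced cross-ratio: both
replacements shrink the product of their lengths by a constant factor. -/
theorem exists_balanced_crossing {E : Finset (V × V)} (hE : ∀ e ∈ E, e.1 < e.2)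
    (hne : (active E).Nonempty) :
    ∃ e ∈ E, ∃ f ∈ E, Interleaved e f ∧
      9 * (len (activeVerts E) e.1 f.1 * len (activeVerts E) e.2 f.2) ≤
        8 * (len (activeVerts E) e.1 e.2 * len (activeVerts E) f.1 f.2) ∧
      9 * (len (activeVerts E) e.1 f.2 * len (activeVerts E) f.1 e.2) ≤
        8 * (len (activeVerts E) e.1 e.2 * len (activeVerts E) f.1 f.2) := by
  set S := activeVerts E with hS
  obtain ⟨s, hs, hmin⟩ := Finset.exists_min_image (active E) (fun e => len S e.1 e.2) hne
  obtain ⟨hsE, f, hfE, hf⟩ := mem_active.1 hs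
  have hfa : f ∈ active E := mem_active.2 ⟨hfE, s, hsE, hf.symm⟩
  have hL : 2 ≤ len S s.1 s.2 := by
    have h2 : s.2 ∈ S := mem_activeVerts.2 ⟨s, hs, Or.inr rfl⟩
    have : ∃ v ∈ S, s.1 < v ∧ v < s.2 := by
      rcases hf with h | h
      · exact ⟨f.1, mem_activeVerts.2 ⟨f, hfa, Or.inl rfl⟩, h.1, h.2.1⟩
      · exact ⟨f.2, mem_activeVerts.2 ⟨f, hfa, Or.inr rfl⟩, h.2.1, h.2.2⟩
    obtain ⟨v, hv, h3, h4⟩ := this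
    rw [len_add S h3.le h4.le]
    have := len_pos h3 hv
    have := len_pos h4 h2
    omega
  -- The median of `s`. Lengths count only active vertices, so `c` is an endpoint of a crossed edge.
  obtain ⟨c, hcS, hac, hcb, hc⟩ := exists_len_eq S (a := s.1) (b := s.2)
    (k := len S s.1 s.2 / 2) (by omega) (by omega)
  have hadd := len_add S hac.le hcb
  set x := len S s.1 c with hx
  set y := len S c s.2 with hy
  obtain ⟨t, ht, htc⟩ := mem_activeVerts.1 hcS
  have hts := hmin t ht
  have htE := (mem_active.1 ht).1
  have ht12 := hE t htE
  -- The first bound amounts to `x * z ≤ 8 * (y * (x + y + z))`. The second amounts to `y * (x + y +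
  -- z) ≤ 8 * (x * z)`, where `y * x`, `y * y`, `y * z` are at most 2, 4, 2 times `x * z`; this
  -- gives the constant. The factors of 2 absorb the rounding of the median.
  have ineq : ∀ x y z : ℕ, y ≤ 2 * x → x ≤ 2 * y → x ≤ z →
      9 * (x * z) ≤ 8 * ((x + y) * (y + z)) ∧ 9 * ((x + y + z) * y) ≤ 8 * ((x + y) * (y + z)) := by
    intro x y z h1 h2 h3
    have i1 := Nat.mul_le_mul_right z h1
    have i2 := Nat.mul_le_mul_right z h2
    have i3 := Nat.mul_le_mul_left y h3
    have i4 := Nat.mul_le_mul_left y h1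
    constructor <;> nlinarith
  rcases htc with htc | htc
  · rw [htc] at ht12
    -- Inside the span of `s`, the edge `t` would be shorter than `s`, against minimality.
    have hlt : s.2 < t.2 := by
      by_contra hcon
      rw [not_lt] at hcon
      have := len_add S ht12.le hcon
      simp only [htc] at hts
      omega
    have hc2 : c < s.2 := by
      refine lt_of_le_of_ne hcb fun h => ?_
      have : y = 0 := by
        rw [hy, h, len, Finset.card_eq_zero, Finset.filter_eq_empty_iff]
        rintro v - ⟨h1, h2⟩
        exact absurd h1 (not_lt.2 h2)
      omega
    refine ⟨s, hsE, t, htE, ⟨by rwa [htc], by rwa [htc], hlt⟩, ?_⟩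
    have h1 := len_add S hcb hlt.le
    have h2 := len_add S (hac.le.trans hcb) hlt.le
    simp only [htc] at hts ⊢
    rw [h1, h2, hadd]
    exact ineq x y _ (by omega) (by omega) (by omega)
  · rw [htc] at ht12
    have hlt : t.1 < s.1 := by
      by_contra hcon
      rw [not_lt] at hcon
      have := len_add S hcon ht12.le
      simp only [htc] at hts
      omega
    have hc2 : c < s.2 := by
      refine lt_of_le_of_ne hcb fun h => ?_
      have : y = 0 := by
        rw [hy, h, len, Finset.card_eq_zero, Finset.filter_eq_empty_iff]
        rintro v - ⟨h1, h2⟩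
        exact absurd h1 (not_lt.2 h2)
      omega
    refine ⟨t, htE, s, hsE, ⟨hlt, by rwa [htc], by rwa [htc]⟩, ?_⟩
    have h1 := len_add S hlt.le hac.le
    have h2 := len_add S (hlt.le.trans hac.le) hcb
    simp only [htc] at hts ⊢
    rw [h2, h1, hadd, ← hx, ← hy]
    have := ineq y x (len S t.1 s.1) (by omega) (by omega) (by omega)
    constructor
    · linarith [this.1]
    · linarith [this.2]

/-- The effect on the weight of replacing two crossing edges by edges `g`, `h` on the same
endpoints, when any edge crossing a new edge crosses an old one. -/
theorem weight_replace_le {E E' : Finset (V × V)} (hE : ∀ e ∈ E, e.1 < e.2) {e f g h : V × V}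
    (he : e ∈ E) (hf : f ∈ E) (hef : Interleaved e f)
    (hg : g = (e.1, f.1) ∧ h = (e.2, f.2) ∨ g = (e.1, f.2) ∧ h = (f.1, e.2))
    (hsub : E' ⊆ (E \ {e, f}) ∪ {g, h})
    (hle : 9 * (len (activeVerts E) g.1 g.2 * len (activeVerts E) h.1 h.2) ≤
        8 * (len (activeVerts E) e.1 e.2 * len (activeVerts E) f.1 f.2)) :
    9 * weight E' ≤ 8 * weight E := by
  have hea : e ∈ active E := mem_active.2 ⟨he, f, hf, Or.inl hef⟩
  have hfa : f ∈ active E := mem_active.2 ⟨hf, e, he, Or.inr hef⟩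
  have hact : active E' ⊆ (active E \ {e, f}) ∪ {g, h} := by
    intro k hk
    obtain ⟨hkE', l, hl, hkl⟩ := mem_active.1 hk
    rcases Finset.mem_union.1 (hsub hkE') with hk1 | hk1
    · refine Finset.mem_union_left _ ?_
      rw [Finset.mem_sdiff] at hk1 ⊢
      refine ⟨?_, hk1.2⟩
      rcases Finset.mem_union.1 (hsub hl) with hl1 | hl1
      · exact mem_active.2 ⟨hk1.1, l, (Finset.mem_sdiff.1 hl1).1, hkl⟩
      -- The edges `e` and `f` cross, so together they connect the two ends of the new edge, which
      -- `k` separates; hence `k` crosses one of them.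
      · have : (Interleaved k e ∨ Interleaved e k) ∨ (Interleaved k f ∨ Interleaved f k) := by
          have hkk := hE k hk1.1
          unfold Interleaved at *
          obtain ⟨e1, e2⟩ := e
          obtain ⟨f1, f2⟩ := f
          obtain ⟨k1, k2⟩ := k
          simp only [Finset.mem_insert, Finset.mem_singleton] at hl1
          rcases hg with ⟨rfl, rfl⟩ | ⟨rfl, rfl⟩ <;> rcases hl1 with rfl | rfl <;>
            simp only at hkl hef hkk ⊢ <;> grind
        rcases this with h | h
        · exact mem_active.2 ⟨hk1.1, e, he, h⟩
        · exact mem_active.2 ⟨hk1.1, f, hf, h⟩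
    · exact Finset.mem_union_right _ hk1
  have mem1 : ∀ k, k ∈ active E → k.1 ∈ activeVerts E :=
    fun _ hk => mem_activeVerts.2 ⟨_, hk, Or.inl rfl⟩
  have mem2 : ∀ k, k ∈ active E → k.2 ∈ activeVerts E :=
    fun _ hk => mem_activeVerts.2 ⟨_, hk, Or.inr rfl⟩
  have hends : ∀ k ∈ (active E \ {e, f}) ∪ {g, h}, k.1 < k.2 ∧ k.1 ∈ activeVerts E ∧
      k.2 ∈ activeVerts E := by
    intro k hk
    rcases Finset.mem_union.1 hk with hk | hk
    · have hk := (Finset.mem_sdiff.1 hk).1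
      exact ⟨hE k (mem_active.1 hk).1, mem1 k hk, mem2 k hk⟩
    · simp only [Finset.mem_insert, Finset.mem_singleton] at hk
      obtain ⟨i1, i2, i3⟩ := hef
      rcases hg with ⟨rfl, rfl⟩ | ⟨rfl, rfl⟩ <;> rcases hk with rfl | rfl
      · exact ⟨i1, mem1 e hea, mem1 f hfa⟩
      · exact ⟨i3, mem2 e hea, mem2 f hfa⟩
      · exact ⟨i1.trans (i2.trans i3), mem1 e hea, mem2 f hfa⟩
      · exact ⟨i2, mem1 f hfa, mem2 e hea⟩
  have hverts : activeVerts E' ⊆ activeVerts E := by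
    intro v hv
    obtain ⟨k, hk, hkv⟩ := mem_activeVerts.1 hv
    rcases hkv with rfl | rfl
    · exact (hends k (hact hk)).2.1
    · exact (hends k (hact hk)).2.2
  have hgh : g ≠ h := by
    obtain ⟨i1, i2, i3⟩ := hef
    rcases hg with ⟨rfl, rfl⟩ | ⟨rfl, rfl⟩ <;> intro hh <;> have hh := congrArg Prod.fst hh
    · exact (i1.trans i2).ne hh
    · exact i1.ne hh
  have hef' : e ≠ f := by
    rintro rfl
    exact lt_irrefl _ hef.1
  have h1 : weight E' ≤ (∏ k ∈ active E \ {e, f}, len (activeVerts E) k.1 k.2) *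
      (len (activeVerts E) g.1 g.2 * len (activeVerts E) h.1 h.2) := by
    calc weight E' ≤ ∏ k ∈ active E', len (activeVerts E) k.1 k.2 :=
          Finset.prod_le_prod' fun k _ => len_mono hverts _ _
      _ ≤ ∏ k ∈ (active E \ {e, f}) ∪ {g, h}, len (activeVerts E) k.1 k.2 :=
          Finset.prod_le_prod_of_subset_of_one_le' hact fun k hk _ =>
            len_pos (hends k hk).1 (hends k hk).2.2
      _ ≤ (∏ k ∈ active E \ {e, f}, len (activeVerts E) k.1 k.2) *
          ∏ k ∈ {g, h}, len (activeVerts E) k.1 k.2 := by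
          -- A new edge may already be present; the factors counted twice are at least 1.
          rw [← Finset.prod_union_inter]
          refine Nat.le_mul_of_pos_right _ (Finset.prod_pos fun k hk => ?_)
          have := hends k (Finset.mem_union_left _ (Finset.mem_inter.1 hk).1)
          exact len_pos this.1 this.2.2
      _ = _ := by rw [Finset.prod_pair hgh]
  have h2 : weight E = (∏ k ∈ active E \ {e, f}, len (activeVerts E) k.1 k.2) *
      (len (activeVerts E) e.1 e.2 * len (activeVerts E) f.1 f.2) := by
    have hss : ({e, f} : Finset (V × V)) ⊆ active E := by
      intro k hk
      simp only [Finset.mem_insert, Finset.mem_singleton] at hk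
      rcases hk with rfl | rfl
      · exact hea
      · exact hfa
    rw [weight, ← Finset.prod_sdiff hss, Finset.prod_pair hef']
  rw [h2]
  calc 9 * weight E' ≤ 9 * (_ * _) := Nat.mul_le_mul_left 9 h1
    _ = (∏ k ∈ active E \ {e, f}, len (activeVerts E) k.1 k.2) *
      (9 * (len (activeVerts E) g.1 g.2 * len (activeVerts E) h.1 h.2)) := by ring
    _ ≤ (∏ k ∈ active E \ {e, f}, len (activeVerts E) k.1 k.2) *
      (8 * (len (activeVerts E) e.1 e.2 * len (activeVerts E) f.1 f.2)) :=
        Nat.mul_le_mul_left _ hle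
    _ = _ := by ring

theorem weight_pos {E : Finset (V × V)} (hE : ∀ e ∈ E, e.1 < e.2) : 0 < weight E :=
  Finset.prod_pos fun e he =>
    len_pos (hE e (mem_active.1 he).1) (mem_activeVerts.2 ⟨e, he, Or.inr rfl⟩)

theorem weight_le [Fintype V] (E : Finset (V × V)) :
    weight E ≤ Fintype.card V ^ (active E).card :=
  Finset.prod_le_pow_card _ _ _ fun _ _ => Finset.card_le_univ _

theorem eq_of_sym2_eq_of_lt {a b c d : V} (hab : a < b) (hcd : c < d) (h : s(a, b) = s(c, d)) :
    (a, b) = (c, d) := by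
  rcases Sym2.eq_iff.1 h with ⟨rfl, rfl⟩ | ⟨rfl, rfl⟩
  · rfl
  · exact absurd hab hcd.asymm

end Potential

/-! ### From flips that shrink the weight to a bound on their number. -/

section Untangle

variable {V : Type*} [LinearOrder V] [Fintype V]

open Classical in
/-- The edges of a graph, as ordered pairs. -/
noncomputable def orderedEdges (G : SimpleGraph V) : Finset (V × V) :=
  Finset.univ.filter fun e => e.1 < e.2 ∧ G.Adj e.1 e.2

theorem mem_orderedEdges {G : SimpleGraph V} {e : V × V} :
    e ∈ orderedEdges G ↔ e.1 < e.2 ∧ G.Adj e.1 e.2 := by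
  simp [orderedEdges]

theorem orderedEdges_subset {T T' : SimpleGraph V} {a b c d a' b' c' d' : V} (h1 : a' < b')
    (h2 : c' < d')
    (h : T'.edgeSet ⊆ (T.edgeSet \ {s(a, b), s(c, d)}) ∪ {s(a', b'), s(c', d')}) :
    orderedEdges T' ⊆ (orderedEdges T \ {(a, b), (c, d)}) ∪ {(a', b'), (c', d')} := by
  rintro ⟨u, v⟩ he
  obtain ⟨huv, hadj⟩ := mem_orderedEdges.1 he
  simp only [Finset.mem_union, Finset.mem_sdiff, Finset.mem_insert, Finset.mem_singleton]
  rcases h (show s(u, v) ∈ T'.edgeSet from hadj) with ⟨h3, h4⟩ | h3 | h3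
  · refine Or.inl ⟨mem_orderedEdges.2 ⟨huv, h3⟩, ?_⟩
    rintro (h5 | h5) <;> cases h5 <;> exact h4 (by simp)
  · exact Or.inr (Or.inl (eq_of_sym2_eq_of_lt huv h1 h3))
  · exact Or.inr (Or.inr (eq_of_sym2_eq_of_lt huv h2 h3))

theorem card_orderedEdges_le {T : SimpleGraph V} (hT : T.IsTree) :
    (orderedEdges T).card ≤ Fintype.card V := by
  have hcard := (SimpleGraph.isTree_iff_connected_and_card.1 hT).2
  have : (orderedEdges T).card ≤ T.edgeSet.ncard := by
    rw [← Set.ncard_coe_finset]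
    refine Set.ncard_le_ncard_of_injOn (fun e => s(e.1, e.2)) ?_ ?_ (Set.toFinite _)
    · intro e he
      exact (mem_orderedEdges.1 he).2
    · intro e he f hf hef
      exact eq_of_sym2_eq_of_lt (mem_orderedEdges.1 he).1 (mem_orderedEdges.1 hf).1 hef
  rw [Nat.card_coe_set_eq, Nat.card_eq_fintype_card] at hcard
  omega

variable {p : V → Plane}

theorem isPlane_of_active_eq_empty
    (ho : ∀ a b c : V, a < b → b < c → 0 < orient (p a) (p b) (p c)) {T : SimpleGraph V}
    (h : active (orderedEdges T) = ∅) : IsPlane p T := by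
  intro a b c d hab hcd hX
  wlog h1 : a < b generalizing a b
  · exact this b a hab.symm hX.swap_left (lt_of_le_of_ne (not_lt.1 h1) hab.ne')
  wlog h2 : c < d generalizing c d
  · exact this d c hcd.symm hX.swap_right (lt_of_le_of_ne (not_lt.1 h2) hcd.ne')
  have : (a, b) ∈ active (orderedEdges T) :=
    mem_active.2 ⟨mem_orderedEdges.2 ⟨h1, hab⟩, (c, d), mem_orderedEdges.2 ⟨h2, hcd⟩,
      interleaved_of_cross ho h1 h2 hX⟩
  rw [h] at this
  exact absurd this (Finset.notMem_empty _)

/-- A nonplane tree has a flip that reduces the weight by a constant factor. -/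
theorem exists_isTreeFlip_weight_le
    (ho : ∀ a b c : V, a < b → b < c → 0 < orient (p a) (p b) (p c)) {T : SimpleGraph V}
    (hT : T.IsTree) (hne : (active (orderedEdges T)).Nonempty) :
    ∃ T', T'.IsTree ∧ IsTreeFlip p T T' ∧
      9 * weight (orderedEdges T') ≤ 8 * weight (orderedEdges T) := by
  have hE : ∀ e ∈ orderedEdges T, e.1 < e.2 := fun e he => (mem_orderedEdges.1 he).1
  obtain ⟨⟨a, b⟩, he, ⟨c, d⟩, hf, hef, hle1, hle2⟩ := exists_balanced_crossing hE hne
  obtain ⟨hac, hcb, hbd⟩ : a < c ∧ c < b ∧ b < d := hef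
  obtain ⟨T', hT', hflip, hsub | hsub⟩ := exists_isTreeFlip hT (mem_orderedEdges.1 he).2
    (mem_orderedEdges.1 hf).2 (cross_of_interleaved ho hac hcb hbd) hac.ne
    (hac.trans (hcb.trans hbd)).ne hcb.ne' hbd.ne
  · exact ⟨T', hT', hflip, weight_replace_le hE he hf ⟨hac, hcb, hbd⟩ (Or.inl ⟨rfl, rfl⟩)
      (orderedEdges_subset hac hbd hsub) hle1⟩
  · rw [Sym2.eq_swap (a := b)] at hsub
    exact ⟨T', hT', hflip, weight_replace_le hE he hf ⟨hac, hcb, hbd⟩ (Or.inr ⟨rfl, rfl⟩)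
      (orderedEdges_subset (hac.trans (hcb.trans hbd)) hcb hsub) hle2⟩

/-- Induction on the weight: each flip divides it by at least `9/8`, and it never falls below 1. -/
theorem exists_hasFlipSequence_pow_le
    (ho : ∀ a b c : V, a < b → b < c → 0 < orient (p a) (p b) (p c)) {T : SimpleGraph V}
    (hT : T.IsTree) :
    ∃ k, HasFlipSequence p T k ∧ (9 / 8 : ℝ) ^ k ≤ weight (orderedEdges T) := by
  induction hw : weight (orderedEdges T) using Nat.strong_induction_on generalizing T with
  | _ w ih =>
    have hpos : 0 < w := hw ▸ weight_pos fun e he => (mem_orderedEdges.1 he).1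
    rcases (active (orderedEdges T)).eq_empty_or_nonempty with h | h
    · exact ⟨0, ⟨fun _ => T, rfl, fun i hi => absurd hi (Nat.not_lt_zero i),
        isPlane_of_active_eq_empty ho h⟩, by rw [pow_zero]; exact_mod_cast hpos⟩
    · obtain ⟨T', hT', hflip, hle⟩ := exists_isTreeFlip_weight_le ho hT h
      rw [hw] at hle
      obtain ⟨k, hk, hpow⟩ := ih _ (by omega) hT' rfl
      refine ⟨k + 1, hk.cons hflip, ?_⟩
      have : (9 : ℝ) * weight (orderedEdges T') ≤ 8 * w := by exact_mod_cast hle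
      rw [pow_succ]
      linarith

end Untangle

theorem exists_hasFlipSequence_le {V : Type*} [Fintype V] {p : V → Plane}
    (hp : ConvexIndependent ℝ p) {T : SimpleGraph V} (hT : T.IsTree) :
    ∃ k : ℕ, HasFlipSequence p T k ∧
      (k : ℝ) ≤ (Real.log (9 / 8))⁻¹ * (Fintype.card V * Real.log (Fintype.card V)) := by
  obtain ⟨_, ho⟩ := exists_linearOrder_orient_pos hp
  obtain ⟨k, hk, hpow⟩ := exists_hasFlipSequence_pow_le ho hT
  refine ⟨k, hk, ?_⟩
  have := hT.connected.nonempty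
  have hn : 0 < Fintype.card V := Fintype.card_pos
  -- A tree has fewer than `n` edges, and each has length at most `n`.
  have hw : weight (orderedEdges T) ≤ Fintype.card V ^ Fintype.card V :=
    (weight_le _).trans <| Nat.pow_le_pow_right hn <|
      (Finset.card_le_card (Finset.filter_subset _ _)).trans (card_orderedEdges_le hT)
  have h1 : (9 / 8 : ℝ) ^ k ≤ (Fintype.card V : ℝ) ^ Fintype.card V :=
    hpow.trans (by exact_mod_cast hw)
  have h2 := Real.log_le_log (by positivity) h1
  rw [Real.log_pow, Real.log_pow] at h2
  have h3 : 0 < Real.log (9 / 8) := Real.log_pos (by norm_num)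
  rw [inv_mul_eq_div, le_div_iff₀ h3]
  exact h2

end GeomGraph

theorem theorem5 :
    ∃ C : ℝ, ∀ (n : ℕ) (P : Finset GeomGraph.Plane) (T : SimpleGraph P),
      P.card = n → GeomGraph.InConvexPosition P → T.IsTree →
      ∃ f : ℕ, GeomGraph.IsMinFlips (fun x : P => (x : GeomGraph.Plane)) T f ∧
        (f : ℝ) ≤ C * ((n : ℝ) * Real.log (n : ℝ)) := by
  classical
  refine ⟨(Real.log (9 / 8))⁻¹, ?_⟩
  rintro n P T rfl hP hT
  obtain ⟨k, hk, hle⟩ := GeomGraph.exists_hasFlipSequence_le hP hT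
  rw [Fintype.card_coe] at hle
  have hex : ∃ k, GeomGraph.HasFlipSequence (fun x : P => (x : GeomGraph.Plane)) T k := ⟨k, hk⟩
  refine ⟨Nat.find hex, ⟨Nat.find_spec hex, fun m hm => Nat.find_min' hex hm⟩, le_trans ?_ hle⟩
  exact_mod_cast Nat.find_min' hex hk
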